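/- Let $n,m\ge 0$ be integers and let $f(z,\overline z)=\sum_{|\alpha|=m}\sum_{|\beta|=m}c_{\alpha\beta}z^\alpha\overline z^\beta$ be a bihomogeneous polynomial of degree $m$ in $z\in\mathbf C^n$ and degree $m$ in $\overline z$ (complex coefficients $c_{\alpha\beta}$, multi-indices $\alpha,\beta\in\mathbf Z_{\ge 0}^n$, $|\alpha|=\sum_j\alpha_j$), such that $f(z,\overline z)$ is real and positive for every $z\neq 0$. For multi-indices $\mu,\nu$ with $|\mu|=|\nu|$ put $$A_{\mu\nu}(z,\overline z)=\sum_{\alpha-\beta=\mu-\nu}c_{\alpha\beta}z^\alpha\overline z^\beta ,$$ where the sum is over $|\alpha|=|\beta|=m$ with $\alpha-\beta=\mu-\nu$. Then there is an integer $N_0$ such that for every $N\ge N_0$ the following hold for the matrices indexed by the multi-indices $\mu,\nu$ with $|\mu|=|\nu|=N$. 1. The matrix $$L_{\mu\nu}=\sum_{\alpha-\beta=\mu-\nu}c_{\alpha\beta}\left(\frac{\mu}{|\mu|}\right)^{\alpha}\left(\frac{\nu}{|\nu|}\right)^{\beta}$$ is Hermitian and positive definite. 2. The (in general non-Hermitian)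 matrix $$A_{\mu\nu}\left(\sqrt{\tfrac{\nu}{|\nu|}},\sqrt{\tfrac{\nu}{|\nu|}}\right)=\sum_{\alpha-\beta=\mu-\nu}c_{\alpha\beta}\left(\frac{\nu}{|\nu|}\right)^{(\alpha+\beta)/2}$$ (square roots taken componentwise) is positive definite, and so is the matrix $$A_{\mu\nu}\left(\tfrac{\nu}{|\nu|},\tfrac{\nu}{|\nu|}\right)=\sum_{\alpha-\beta=\mu-\nu}c_{\alpha\beta}\left(\frac{\nu}{|\nu|}\right)^{\alpha+\beta}.$$ Here a square complex matrix $M$, not necessarily Hermitian, is called positive definite if $\operatorname{Re}\sum_{\mu,\nu}M_{\mu\nu}\zeta_\mu\overline{\zeta_\nu}>0$ for all $\zeta\ne0$, i.e. if its Hermitian part $(M+M^*)/2$ is positive definite. -/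

import Mathlib

open scoped ComplexOrder ComplexConjugate

noncomputable section

/-- Multi-indices `α` in `n` variables with `|α| = α₁ + ⋯ + αₙ = k`. -/
abbrev MultiIndex (n k : ℕ) : Type := {α : Fin n → ℕ // ∑ i, α i = k}

instance MultiIndex.instFintype (n k : ℕ) : Fintype (MultiIndex n k) :=
  Fintype.subtype (Finset.piAntidiag Finset.univ k) (by simp)

/-- The monomial `z ^ α = ∏ zᵢ ^ αᵢ`. -/
def monom {n : ℕ} (z : Fin n → ℂ) (α : Fin n → ℕ) : ℂ := ∏ i, z i ^ α i

/-- The value `f(z, z̄) = ∑_{|α| = m} ∑_{|β| = m} c_{αβ} z^α z̄^β` of the bihomogeneous polynomial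
with underlying matrix of coefficients `c`. -/
def bihomEval {n m : ℕ} (c : Matrix (MultiIndex n m) (MultiIndex n m) ℂ) (z : Fin n → ℂ) : ℂ :=
  ∑ α, ∑ β, c α β * monom z α.1 * monom (fun i => conj (z i)) β.1

/-- The point `μ / |μ|`, for a multi-index with `|μ| = N`. -/
def simplexPoint {n N : ℕ} (μ : MultiIndex n N) : Fin n → ℂ :=
  fun i => (((μ.1 i : ℝ) / (N : ℝ) : ℝ) : ℂ)

/-- The point `√(μ / |μ|)` (componentwise square root), for a multi-index with `|μ| = N`. -/
def sqrtSimplexPoint {n N : ℕ} (μ : MultiIndex n N) : Fin n → ℂ :=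
  fun i => ((Real.sqrt ((μ.1 i : ℝ) / (N : ℝ)) : ℝ) : ℂ)

/-- The entry `L_{μν} = ∑_{α - β = μ - ν} c_{αβ} (μ/|μ|)^α (ν/|ν|)^β`. The condition
`α - β = μ - ν` between integer vectors is written additively. -/
def matrixL {n m : ℕ} (c : Matrix (MultiIndex n m) (MultiIndex n m) ℂ) (N : ℕ) :
    Matrix (MultiIndex n N) (MultiIndex n N) ℂ :=
  fun μ ν => ∑ α : MultiIndex n m, ∑ β : MultiIndex n m,
    if α.1 + ν.1 = β.1 + μ.1 then
      c α β * monom (simplexPoint μ) α.1 * monom (simplexPoint ν) β.1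
    else 0

/-- The entry `A_{μν}(z, z̄) = ∑_{α - β = μ - ν} c_{αβ} z^α z̄^β`. -/
def entryA {n m N : ℕ} (c : Matrix (MultiIndex n m) (MultiIndex n m) ℂ)
    (μ ν : MultiIndex n N) (z : Fin n → ℂ) : ℂ :=
  ∑ α : MultiIndex n m, ∑ β : MultiIndex n m,
    if α.1 + ν.1 = β.1 + μ.1 then
      c α β * monom z α.1 * monom (fun i => conj (z i)) β.1
    else 0

/-- The matrix with entries `A_{μν}(√(ν/|ν|), √(ν/|ν|))`. -/
def matrixASqrt {n m : ℕ} (c : Matrix (MultiIndex n m) (MultiIndex n m) ℂ) (N : ℕ) :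
    Matrix (MultiIndex n N) (MultiIndex n N) ℂ :=
  fun μ ν => entryA c μ ν (sqrtSimplexPoint ν)

/-- The matrix with entries `∑_{α - β = μ - ν} c_{αβ} (ν/|ν|)^(α + β)`. -/
def matrixAColumn {n m : ℕ} (c : Matrix (MultiIndex n m) (MultiIndex n m) ℂ) (N : ℕ) :
    Matrix (MultiIndex n N) (MultiIndex n N) ℂ :=
  fun μ ν => ∑ α : MultiIndex n m, ∑ β : MultiIndex n m,
    if α.1 + ν.1 = β.1 + μ.1 then
      c α β * monom (simplexPoint ν) (α.1 + β.1)
    else 0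

/-- Positive definiteness of a complex square matrix that need not be Hermitian:
`Re ∑ M_{μν} ζ_μ conj ζ_ν > 0` for all `ζ ≠ 0`, that is, `(M + Mᴴ) / 2` is positive definite.
For Hermitian `M` this is the usual notion. -/
def RePosDef {ι : Type} [Fintype ι] (M : Matrix ι ι ℂ) : Prop :=
  ∀ ζ : ι → ℂ, ζ ≠ 0 → 0 < (∑ μ, ∑ ν, M μ ν * ζ μ * conj (ζ ν)).re

end

/-! ### Monomials -/

/-! All three matrices are band matrices whose coefficients sample a continuous `h` at `(μ/N, ν/N)`.
On the diagonal `h (x, x)` is the coefficient array of `θ ↦ f (w x · e^{iθ})`, with `w x = x` or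
`√x`. For large `N` such a matrix is locally almost Toeplitz, and its symbol is bounded below by
some `δ > 0` on the compact product of simplex and torus.

To localize, cut `ζ` down to the `μ` whose box `μ + [0, R]^n` contains a given lattice point `q`,
and freeze the coefficients at one such index. Each frozen form is at least `δ` times the mass of
its piece (`le_re_formValue_toeplitz`). Summing over `q` counts a pair `μ, ν` as often as its two
boxes share a point, which within the band is almost `(R + 1)^n` times (`le_card_Icc_inter_Icc`). So
the sum differs from `(R + 1)^n` times the original form by a band form with small coefficients,
controlled by `norm_formValue_bandMatrix_le`. This gives `exists_rePosDef_bandMatrix`, which never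
needs the matrix to be Hermitian. That `L` is Hermitian is separate: a real-valued `f` has Hermitian
coefficients, by polarization. -/

lemma monom_add {n : ℕ} (z : Fin n → ℂ) (α β : Fin n → ℕ) :
    monom z (α + β) = monom z α * monom z β := by
  simp [monom, pow_add, Finset.prod_mul_distrib]

lemma monom_mul {n : ℕ} (z w : Fin n → ℂ) (α : Fin n → ℕ) :
    monom (fun i => z i * w i) α = monom z α * monom w α := by
  simp [monom, mul_pow, Finset.prod_mul_distrib]

lemma monom_conj {n : ℕ} (z : Fin n → ℂ) (α : Fin n → ℕ) :
    monom (fun i => conj (z i)) α = conj (monom z α) := by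
  simp [monom]

lemma continuous_monom {n : ℕ} (α : Fin n → ℕ) : Continuous (fun z : Fin n → ℂ => monom z α) := by
  unfold monom
  fun_prop

/-- Orthogonality of monomials on the finite torus of `K`-th roots of unity. -/
lemma sum_monom_stdAddChar {n K : ℕ} [NeZero K] {a b : Fin n → ℕ} (ha : ∀ i, a i < K)
    (hb : ∀ i, b i < K) :
    ∑ t : Fin n → ZMod K, monom (fun i => ZMod.stdAddChar (t i)) a *
      conj (monom (fun i => ZMod.stdAddChar (t i)) b) = if a = b then (K : ℂ) ^ n else 0 := by
  have h1 : ∀ t : Fin n → ZMod K, monom (fun i => ZMod.stdAddChar (t i)) a *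
      conj (monom (fun i => ZMod.stdAddChar (t i)) b) =
      ∏ i, ZMod.stdAddChar (t i * ((a i : ZMod K) - (b i : ZMod K))) := by
    intro t
    simp only [monom, map_prod, map_pow, ← Finset.prod_mul_distrib]
    refine Finset.prod_congr rfl fun i _ => ?_
    rw [← AddChar.map_neg_eq_conj, ← AddChar.map_nsmul_eq_pow, ← AddChar.map_nsmul_eq_pow,
      ← AddChar.map_add_eq_mul]
    congr 1
    simp only [nsmul_eq_mul]
    ring
  simp_rw [h1]
  rw [← Fintype.piFinset_univ, ← Finset.prod_univ_sum (fun _ : Fin n => (Finset.univ : Finset (ZMod K)))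
    (fun i x => ZMod.stdAddChar (x * ((a i : ZMod K) - (b i : ZMod K))))]
  simp_rw [AddChar.sum_mulShift _ (ZMod.isPrimitive_stdAddChar K)]
  -- Exponents below `K` are determined by their residues, so no aliasing occurs.
  have h2 : ∀ i, ((a i : ZMod K) - (b i : ZMod K) = 0) ↔ a i = b i := by
    intro i
    rw [sub_eq_zero, ZMod.natCast_eq_natCast_iff', Nat.mod_eq_of_lt (ha i), Nat.mod_eq_of_lt (hb i)]
  simp_rw [h2]
  split_ifs with h
  · subst h
    simp [ZMod.card]
  · obtain ⟨i, hi⟩ := Function.ne_iff.mp h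
    exact Finset.prod_eq_zero (Finset.mem_univ i) (by simp [hi])

lemma MultiIndex.apply_le {n k : ℕ} (α : MultiIndex n k) (i : Fin n) : α.1 i ≤ k := by
  have := Finset.single_le_sum (f := α.1) (fun _ _ => Nat.zero_le _) (Finset.mem_univ i)
  rwa [α.2] at this

/-! ### Sesquilinear forms and band matrices -/

/-- The value `∑ M_{μν} ζ_μ conj ζ_ν`. -/
noncomputable def formValue {ι : Type} [Fintype ι] (M : Matrix ι ι ℂ) (ζ : ι → ℂ) : ℂ :=
  ∑ μ, ∑ ν, M μ ν * ζ μ * conj (ζ ν)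

/-- The matrix with entries `∑_{α - β = μ - ν} h_{μν αβ}`. -/
def bandMatrix {n m N : ℕ}
    (h : MultiIndex n N → MultiIndex n N → MultiIndex n m → MultiIndex n m → ℂ) :
    Matrix (MultiIndex n N) (MultiIndex n N) ℂ :=
  fun μ ν => ∑ α, ∑ β, if α.1 + ν.1 = β.1 + μ.1 then h μ ν α β else 0

lemma formValue_bandMatrix {n m N : ℕ}
    (h : MultiIndex n N → MultiIndex n N → MultiIndex n m → MultiIndex n m → ℂ)
    (ζ : MultiIndex n N → ℂ) :
    formValue (bandMatrix h) ζ = ∑ α : MultiIndex n m, ∑ β : MultiIndex n m, ∑ μ, ∑ ν,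
      if α.1 + ν.1 = β.1 + μ.1 then h μ ν α β * ζ μ * conj (ζ ν) else 0 := by
  simp only [formValue, bandMatrix, Finset.sum_mul, ite_mul, zero_mul]
  calc _ = ∑ μ, ∑ α : MultiIndex n m, ∑ ν, ∑ β : MultiIndex n m,
        (if α.1 + ν.1 = β.1 + μ.1 then h μ ν α β * ζ μ * conj (ζ ν) else 0) :=
        Finset.sum_congr rfl fun μ _ => Finset.sum_comm
    _ = ∑ α : MultiIndex n m, ∑ μ, ∑ ν, ∑ β : MultiIndex n m,
        (if α.1 + ν.1 = β.1 + μ.1 then h μ ν α β * ζ μ * conj (ζ ν) else 0) := Finset.sum_comm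
    _ = ∑ α : MultiIndex n m, ∑ μ, ∑ β : MultiIndex n m, ∑ ν,
        (if α.1 + ν.1 = β.1 + μ.1 then h μ ν α β * ζ μ * conj (ζ ν) else 0) :=
        Finset.sum_congr rfl fun α _ => Finset.sum_congr rfl fun μ _ => Finset.sum_comm
    _ = _ := Finset.sum_congr rfl fun α _ => Finset.sum_comm

/-- A band matrix with coefficients bounded by `ε` has form bounded by `ε` times the squared
number of bands. -/
lemma norm_formValue_bandMatrix_le {n m N : ℕ}
    (h : MultiIndex n N → MultiIndex n N → MultiIndex n m → MultiIndex n m → ℂ) {ε : ℝ}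
    (hε : 0 ≤ ε) (hh : ∀ μ ν (α β : MultiIndex n m), α.1 + ν.1 = β.1 + μ.1 → ‖h μ ν α β‖ ≤ ε)
    (ζ : MultiIndex n N → ℂ) :
    ‖formValue (bandMatrix h) ζ‖ ≤
      (Fintype.card (MultiIndex n m) : ℝ) ^ 2 * (ε * ∑ μ, ‖ζ μ‖ ^ 2) := by
  rw [formValue_bandMatrix]
  -- For fixed `α, β` the relation allows at most one `ν` per `μ` and one `μ` per `ν`, so the Schur
  -- test bounds this band by `ε`.
  have key : ∀ α β : MultiIndex n m, ‖∑ μ, ∑ ν,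
      if α.1 + ν.1 = β.1 + μ.1 then h μ ν α β * ζ μ * conj (ζ ν) else 0‖ ≤
      ε * ∑ μ, ‖ζ μ‖ ^ 2 := by
    intro α β
    have hrow : ∑ μ : MultiIndex n N, ∑ ν : MultiIndex n N, (if α.1 + ν.1 = β.1 + μ.1 then ‖ζ μ‖ ^ 2 else 0) ≤ ∑ μ, ‖ζ μ‖ ^ 2 := by
      refine Finset.sum_le_sum fun μ _ => ?_
      rw [← Finset.sum_filter, Finset.sum_const, nsmul_eq_mul]
      have : (Finset.univ.filter fun ν : MultiIndex n N => α.1 + ν.1 = β.1 + μ.1).card ≤ 1 := by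
        refine Finset.card_le_one.mpr fun x hx y hy => ?_
        simp only [Finset.mem_filter, Finset.mem_univ, true_and] at hx hy
        exact Subtype.ext (add_left_cancel (hx.trans hy.symm))
      have h1 : ((Finset.univ.filter fun ν : MultiIndex n N => α.1 + ν.1 = β.1 + μ.1).card : ℝ) ≤ 1 := by
        exact_mod_cast this
      exact mul_le_of_le_one_left (by positivity) h1
    have hcol : ∑ μ : MultiIndex n N, ∑ ν : MultiIndex n N, (if α.1 + ν.1 = β.1 + μ.1 then ‖ζ ν‖ ^ 2 else 0) ≤ ∑ μ, ‖ζ μ‖ ^ 2 := by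
      rw [Finset.sum_comm]
      refine Finset.sum_le_sum fun ν _ => ?_
      rw [← Finset.sum_filter, Finset.sum_const, nsmul_eq_mul]
      have : (Finset.univ.filter fun μ : MultiIndex n N => α.1 + ν.1 = β.1 + μ.1).card ≤ 1 := by
        refine Finset.card_le_one.mpr fun x hx y hy => ?_
        simp only [Finset.mem_filter, Finset.mem_univ, true_and] at hx hy
        exact Subtype.ext (add_left_cancel (hx.symm.trans hy))
      have h1 : ((Finset.univ.filter fun μ : MultiIndex n N => α.1 + ν.1 = β.1 + μ.1).card : ℝ) ≤ 1 := by
        exact_mod_cast this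
      exact mul_le_of_le_one_left (by positivity) h1
    calc _ ≤ ∑ μ : MultiIndex n N, ∑ ν : MultiIndex n N, ‖if α.1 + ν.1 = β.1 + μ.1 then h μ ν α β * ζ μ * conj (ζ ν) else 0‖ :=
          norm_sum_le_of_le _ fun (μ : MultiIndex n N) _ => norm_sum_le _ _
      _ ≤ ∑ μ : MultiIndex n N, ∑ ν : MultiIndex n N, (ε / 2 * (if α.1 + ν.1 = β.1 + μ.1 then ‖ζ μ‖ ^ 2 else 0) +
            ε / 2 * (if α.1 + ν.1 = β.1 + μ.1 then ‖ζ ν‖ ^ 2 else 0)) := by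
          refine Finset.sum_le_sum fun μ _ => Finset.sum_le_sum fun ν _ => ?_
          split_ifs with hr
          · rw [norm_mul, norm_mul, RCLike.norm_conj]
            have h1 := hh μ ν α β hr
            have h2 : ‖ζ μ‖ * ‖ζ ν‖ ≤ (‖ζ μ‖ ^ 2 + ‖ζ ν‖ ^ 2) / 2 := by
              nlinarith [sq_nonneg (‖ζ μ‖ - ‖ζ ν‖)]
            calc ‖h μ ν α β‖ * ‖ζ μ‖ * ‖ζ ν‖ = ‖h μ ν α β‖ * (‖ζ μ‖ * ‖ζ ν‖) := by ring
              _ ≤ ε * ((‖ζ μ‖ ^ 2 + ‖ζ ν‖ ^ 2) / 2) := by gcongr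
              _ = _ := by ring
          · simp
      _ = ε / 2 * (∑ μ : MultiIndex n N, ∑ ν : MultiIndex n N, (if α.1 + ν.1 = β.1 + μ.1 then ‖ζ μ‖ ^ 2 else 0)) +
            ε / 2 * ∑ μ : MultiIndex n N, ∑ ν : MultiIndex n N, (if α.1 + ν.1 = β.1 + μ.1 then ‖ζ ν‖ ^ 2 else 0) := by
          simp only [Finset.sum_add_distrib, Finset.mul_sum]
      _ ≤ ε / 2 * (∑ μ, ‖ζ μ‖ ^ 2) + ε / 2 * ∑ μ, ‖ζ μ‖ ^ 2 := by gcongr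
      _ = _ := by ring
  calc _ ≤ ∑ α : MultiIndex n m, ∑ β : MultiIndex n m, ε * ∑ μ, ‖ζ μ‖ ^ 2 :=
        norm_sum_le_of_le _ fun α _ => norm_sum_le_of_le _ fun β _ => key α β
    _ = _ := by
        simp only [Finset.sum_const, Finset.card_univ, nsmul_eq_mul]
        ring

/-! ### Toeplitz matrices with positive symbol -/

/-- A finite section of the Toeplitz matrix with symbol `θ ↦ f (u e^{iθ})` is bounded below by any
lower bound of the symbol. -/
lemma le_re_formValue_toeplitz {n m N : ℕ} (c : Matrix (MultiIndex n m) (MultiIndex n m) ℂ)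
    (u : Fin n → ℂ) {δ : ℝ}
    (hδ : ∀ e : Fin n → ℂ, (∀ i, ‖e i‖ = 1) → δ ≤ (bihomEval c (fun i => u i * e i)).re)
    (η : MultiIndex n N → ℂ) :
    δ * ∑ μ, ‖η μ‖ ^ 2 ≤ (formValue (bandMatrix (N := N) fun _ _ α β =>
      c α β * monom u α.1 * monom (fun i => conj (u i)) β.1) η).re := by
  -- The exponents `α + ν` and `β + μ` have entries at most `N + m`, so orthogonality modulo this
  -- `K` is exact.
  set K := N + m + 1 with hK
  have : NeZero K := ⟨by omega⟩
  set e : (Fin n → ZMod K) → Fin n → ℂ := fun t i => ZMod.stdAddChar (t i) with he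
  set S : (Fin n → ZMod K) → ℂ := fun t => ∑ μ : MultiIndex n N, η μ * conj (monom (e t) μ.1) with hS
  have hSS : ∀ t, S t * conj (S t) = ∑ μ : MultiIndex n N, ∑ ν : MultiIndex n N,
      η μ * conj (η ν) * (monom (e t) ν.1 * conj (monom (e t) μ.1)) := by
    intro t
    simp only [hS, map_sum, Finset.sum_mul_sum, map_mul, Complex.conj_conj]
    refine Finset.sum_congr rfl fun μ _ => Finset.sum_congr rfl fun ν _ => by ring
  have hmass : ∑ t, S t * conj (S t) = (K : ℂ) ^ n * ∑ μ, ((‖η μ‖ ^ 2 : ℝ) : ℂ) := by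
    simp_rw [hSS]
    rw [Finset.sum_comm, Finset.mul_sum]
    refine Finset.sum_congr rfl fun μ _ => ?_
    rw [Finset.sum_comm]
    simp_rw [← Finset.mul_sum]
    rw [Finset.sum_eq_single μ]
    · rw [sum_monom_stdAddChar (fun i => by have := μ.apply_le i; omega)
        (fun i => by have := μ.apply_le i; omega), if_pos rfl, Complex.mul_conj,
        Complex.normSq_eq_norm_sq]
      ring
    · intro ν _ hν
      rw [sum_monom_stdAddChar (fun i => by have := ν.apply_le i; omega)
        (fun i => by have := μ.apply_le i; omega), if_neg (fun h => hν (Subtype.ext h)), mul_zero]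
    · simp
  -- Averaging the symbol against `|S|²` over the finite torus yields the form; averaging `|S|²`
  -- alone yields the mass of `η`.
  have hform : ∑ t, bihomEval c (fun i => u i * e t i) * (S t * conj (S t)) =
      (K : ℂ) ^ n * formValue (bandMatrix (N := N) fun _ _ α β =>
        c α β * monom u α.1 * monom (fun i => conj (u i)) β.1) η := by
    have hexp : ∀ t, bihomEval c (fun i => u i * e t i) * (S t * conj (S t)) =
        ∑ α : MultiIndex n m, ∑ β : MultiIndex n m, ∑ μ : MultiIndex n N, ∑ ν : MultiIndex n N,
          c α β * monom u α.1 * monom (fun i => conj (u i)) β.1 * η μ * conj (η ν) *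
            (monom (e t) (α.1 + ν.1) * conj (monom (e t) (β.1 + μ.1))) := by
      intro t
      rw [hSS, bihomEval, Finset.sum_mul]
      refine Finset.sum_congr rfl fun α _ => ?_
      rw [Finset.sum_mul]
      refine Finset.sum_congr rfl fun β _ => ?_
      rw [Finset.mul_sum]
      refine Finset.sum_congr rfl fun μ _ => ?_
      rw [Finset.mul_sum]
      refine Finset.sum_congr rfl fun ν _ => ?_
      rw [monom_conj, monom_conj, monom_mul, monom_mul, monom_add, monom_add, map_mul, map_mul]
      ring
    simp_rw [hexp]
    rw [formValue_bandMatrix, Finset.sum_comm, Finset.mul_sum]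
    refine Finset.sum_congr rfl fun α _ => ?_
    rw [Finset.sum_comm, Finset.mul_sum]
    refine Finset.sum_congr rfl fun β _ => ?_
    rw [Finset.sum_comm, Finset.mul_sum]
    refine Finset.sum_congr rfl fun μ _ => ?_
    rw [Finset.sum_comm, Finset.mul_sum]
    refine Finset.sum_congr rfl fun ν _ => ?_
    rw [← Finset.mul_sum, sum_monom_stdAddChar
      (fun i => by have := ν.apply_le i; have := α.apply_le i; simp only [Pi.add_apply]; omega)
      (fun i => by have := μ.apply_le i; have := β.apply_le i; simp only [Pi.add_apply]; omega)]
    split_ifs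
    · ring
    · simp
  have hKpos : (0 : ℝ) < (K : ℝ) ^ n := by positivity
  have hre : ∀ (x : ℂ) (s : ℂ), (x * (s * conj s)).re = x.re * Complex.normSq s := by
    intro x s
    rw [Complex.mul_conj, Complex.re_mul_ofReal]
  have h1 : ((K : ℂ) ^ n) = (((K : ℝ) ^ n : ℝ) : ℂ) := by push_cast; rfl
  have hm := congrArg Complex.re hmass
  have hf := congrArg Complex.re hform
  rw [h1, Complex.re_ofReal_mul, Complex.re_sum] at hm hf
  have hone : ∀ t, (S t * conj (S t)).re = Complex.normSq (S t) := fun t => by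
    rw [Complex.mul_conj, Complex.ofReal_re]
  simp only [hone, Complex.ofReal_re, Complex.re_sum] at hm
  simp only [hre] at hf
  refine le_of_mul_le_mul_left ?_ hKpos
  rw [← hf, mul_left_comm, ← hm, Finset.mul_sum]
  refine Finset.sum_le_sum fun t _ => ?_
  exact mul_le_mul_of_nonneg_right (hδ (e t) fun i => AddChar.norm_apply _ _) (Complex.normSq_nonneg _)

/-! ### Real bihomogeneous polynomials have Hermitian coefficients -/

/-- Polarization: `z` and `z̄` can be treated as independent variables. Writing `z = x + iy`, a
polynomial vanishing at all real `x, y` is zero, and a linear change of variables over `ℂ` then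
separates `z` from `z̄`. -/
lemma eq_zero_of_forall_bihomEval_eq_zero {n m : ℕ} (d : Matrix (MultiIndex n m) (MultiIndex n m) ℂ)
    (hd : ∀ z : Fin n → ℂ, bihomEval d z = 0) : d = 0 := by
  let P (a b : Fin n → MvPolynomial (Fin n ⊕ Fin n) ℂ) : MvPolynomial (Fin n ⊕ Fin n) ℂ :=
    ∑ α : MultiIndex n m, ∑ β : MultiIndex n m,
      MvPolynomial.C (d α β) * (∏ i, a i ^ α.1 i) * ∏ i, b i ^ β.1 i
  have hPeval : ∀ a b x, MvPolynomial.eval x (P a b) =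
      ∑ α : MultiIndex n m, ∑ β : MultiIndex n m, d α β *
        monom (fun i => MvPolynomial.eval x (a i)) α.1 *
        monom (fun i => MvPolynomial.eval x (b i)) β.1 := by
    intro a b x
    simp [P, monom]
  have hQ : P (fun i => .X (.inl i) + .C Complex.I * .X (.inr i))
      (fun i => .X (.inl i) - .C Complex.I * .X (.inr i)) = 0 := by
    refine MvPolynomial.funext_set (fun _ => Set.range ((↑) : ℝ → ℂ))
      (fun _ => Set.infinite_range_of_injective Complex.ofReal_injective) fun x hx => ?_
    choose y hy using fun i => hx i (Set.mem_univ i)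
    rw [map_zero, ← hd (fun i => x (.inl i) + Complex.I * x (.inr i)), hPeval, bihomEval]
    refine Finset.sum_congr rfl fun α _ => Finset.sum_congr rfl fun β _ => ?_
    simp [← hy, sub_eq_add_neg]
  have hP : P (fun i => .X (.inl i)) (fun i => .X (.inr i)) = 0 := by
    refine MvPolynomial.funext fun x => ?_
    have h := congrArg (MvPolynomial.eval (Sum.elim (fun i => (x (.inl i) + x (.inr i)) / 2)
      (fun i => (x (.inl i) - x (.inr i)) / (2 * Complex.I)))) hQ
    rw [hPeval, map_zero] at h
    rw [hPeval, map_zero, ← h]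
    refine Finset.sum_congr rfl fun α _ => Finset.sum_congr rfl fun β _ => ?_
    have h1 : ∀ i, (x (.inl i) + x (.inr i)) / 2 +
        Complex.I * ((x (.inl i) - x (.inr i)) / (2 * Complex.I)) = x (.inl i) := by
      intro i; field_simp; ring
    have h2 : ∀ i, (x (.inl i) + x (.inr i)) / 2 -
        Complex.I * ((x (.inl i) - x (.inr i)) / (2 * Complex.I)) = x (.inr i) := by
      intro i; field_simp; ring
    simp [h1, h2]
  ext α β
  let s (α β : MultiIndex n m) : (Fin n ⊕ Fin n) →₀ ℕ := Finsupp.equivFunOnFinite.symm (Sum.elim α.1 β.1)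
  have hmon : ∀ α β : MultiIndex n m, MvPolynomial.C (d α β) *
      (∏ i, (MvPolynomial.X (.inl i) : MvPolynomial (Fin n ⊕ Fin n) ℂ) ^ α.1 i) *
      ∏ i, (MvPolynomial.X (.inr i) : MvPolynomial (Fin n ⊕ Fin n) ℂ) ^ β.1 i =
      MvPolynomial.monomial (s α β) (d α β) := by
    intro α β
    rw [MvPolynomial.monomial_eq, Finsupp.prod_fintype _ _ (by simp), Fintype.prod_sum_type]
    simp [s, mul_assoc]
  have h := congrArg (MvPolynomial.coeff (s α β)) hP
  simp only [P, hmon, MvPolynomial.coeff_sum, MvPolynomial.coeff_monomial,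
    MvPolynomial.coeff_zero] at h
  rw [Finset.sum_eq_single α, Finset.sum_eq_single β] at h
  · simpa using h
  · intro β' _ hne
    refine if_neg fun h => hne (Subtype.ext ?_)
    have := Finsupp.equivFunOnFinite.symm.injective h
    exact funext fun i => congrFun this (.inr i)
  · simp
  · intro α' _ hne
    refine Finset.sum_eq_zero fun β' _ => if_neg fun h => hne (Subtype.ext ?_)
    have := Finsupp.equivFunOnFinite.symm.injective h
    exact funext fun i => congrFun this (.inl i)
  · simp

lemma isHermitian_of_bihomEval_real {n m : ℕ} {c : Matrix (MultiIndex n m) (MultiIndex n m) ℂ}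
    (hc : ∀ z : Fin n → ℂ, conj (bihomEval c z) = bihomEval c z) : c.IsHermitian := by
  rw [Matrix.IsHermitian, ← sub_eq_zero]
  refine eq_zero_of_forall_bihomEval_eq_zero _ fun z => ?_
  have h : bihomEval c.conjTranspose z = conj (bihomEval c z) := by
    simp only [bihomEval, map_sum, map_mul, monom_conj, Complex.conj_conj, Matrix.conjTranspose_apply]
    rw [Finset.sum_comm]
    refine Finset.sum_congr rfl fun β _ => Finset.sum_congr rfl fun α _ => ?_
    rw [Complex.star_def]
    ring
  have h2 : bihomEval (c.conjTranspose - c) z = bihomEval c.conjTranspose z - bihomEval c z := by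
    simp [bihomEval, sub_mul, Finset.sum_sub_distrib]
  rw [h2, h, hc, sub_self]

/-! ### Freezing on boxes -/

/-- The boxes of side `R` based at two points at distance at most `m` overlap in a proportion
`1 - ε` of their points as soon as `R ≥ n m / ε`. -/
lemma le_card_Icc_inter_Icc {n m R : ℕ} {ε : ℝ} (hmR : m ≤ R) (hR : (n : ℝ) * m ≤ ε * (R + 1))
    {a b : Fin n → ℕ} (hab : ∀ i, a i ≤ b i + m) (hba : ∀ i, b i ≤ a i + m) :
    (1 - ε) * ((R : ℝ) + 1) ^ n ≤
      ((Finset.Icc a (fun i => a i + R) ∩ Finset.Icc b (fun i => b i + R)).card : ℝ) := by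
  have h1 : (R + 1 - m) ^ n ≤
      (Finset.Icc a (fun i => a i + R) ∩ Finset.Icc b (fun i => b i + R)).card := by
    have hinter : Finset.Icc a (fun i => a i + R) ∩ Finset.Icc b (fun i => b i + R) =
        Finset.Icc (a ⊔ b) ((fun i => a i + R) ⊓ (fun i => b i + R)) := by
      ext q
      simp only [Finset.mem_inter, Finset.mem_Icc, sup_le_iff, le_inf_iff]
      tauto
    rw [hinter, Pi.card_Icc]
    calc (R + 1 - m) ^ n = ∏ _i : Fin n, (R + 1 - m) := by simp
      _ ≤ _ := Finset.prod_le_prod' fun i _ => by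
        have := hab i
        have := hba i
        simp only [Nat.card_Icc, Pi.sup_apply, Pi.inf_apply]
        omega
  have h2 : (((R + 1 - m) ^ n : ℕ) : ℝ) = ((R : ℝ) + 1 - m) ^ n := by
    rw [Nat.cast_pow, Nat.cast_sub (by omega)]
    push_cast
    rfl
  have hpos : (0 : ℝ) < R + 1 := by positivity
  have hm1 : (m : ℝ) / (R + 1) ≤ 1 := by
    rw [div_le_one hpos]
    have : (m : ℝ) ≤ R := by exact_mod_cast hmR
    linarith
  -- Bernoulli's inequality for `(1 - m/(R+1))^n`.
  have h3 := one_add_mul_le_pow (a := -((m : ℝ) / (R + 1))) (by linarith) n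
  have h4 : (n : ℝ) * (m / (R + 1)) ≤ ε := by
    rw [← mul_div_assoc, div_le_iff₀ hpos]
    exact hR
  calc (1 - ε) * ((R : ℝ) + 1) ^ n ≤ (1 + -((m : ℝ) / (R + 1))) ^ n * ((R : ℝ) + 1) ^ n := by
        gcongr
        linarith
    _ = ((R : ℝ) + 1 - m) ^ n := by
        rw [← mul_pow]
        congr 1
        field_simp
        ring
    _ ≤ _ := by
        rw [← h2]
        exact_mod_cast h1

/-- The point `μ / |μ|` as a real vector. -/
noncomputable def realSimplexPoint {n N : ℕ} (μ : MultiIndex n N) : Fin n → ℝ :=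
  fun i => (μ.1 i : ℝ) / N

lemma realSimplexPoint_mem {n N : ℕ} (hN : 0 < N) (μ : MultiIndex n N) :
    realSimplexPoint μ ∈ stdSimplex ℝ (Fin n) := by
  refine ⟨fun i => by unfold realSimplexPoint; positivity, ?_⟩
  have : (N : ℝ) ≠ 0 := by positivity
  simp only [realSimplexPoint]
  rw [← Finset.sum_div, ← Nat.cast_sum, μ.2, div_self this]

lemma dist_realSimplexPoint_le {n N R : ℕ} {μ ρ : MultiIndex n N} {q : Fin n → ℕ}
    (hμ : q ∈ Finset.Icc μ.1 (fun i => μ.1 i + R)) (hρ : q ∈ Finset.Icc ρ.1 (fun i => ρ.1 i + R)) :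
    dist (realSimplexPoint μ) (realSimplexPoint ρ) ≤ (R : ℝ) / N := by
  rw [dist_pi_le_iff (by positivity)]
  intro i
  rw [Finset.mem_Icc] at hμ hρ
  have h1 : q i ≤ μ.1 i + R := hμ.2 i
  have h2 : q i ≤ ρ.1 i + R := hρ.2 i
  have h3 : (μ.1 i : ℝ) ≤ ρ.1 i + R := by exact_mod_cast (hμ.1 i).trans h2
  have h4 : (ρ.1 i : ℝ) ≤ μ.1 i + R := by exact_mod_cast (hρ.1 i).trans h1
  simp only [realSimplexPoint]
  rw [Real.dist_eq, ← sub_div, abs_div, Nat.abs_cast]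
  gcongr
  rw [abs_le]
  constructor <;> linarith

/-- Summing the forms of frozen band matrices over all boxes. -/
lemma sum_formValue_bandMatrix_box {n m N : ℕ} (B : MultiIndex n N → Finset (Fin n → ℕ))
    (g : (Fin n → ℕ) → MultiIndex n m → MultiIndex n m → ℂ) (ζ : MultiIndex n N → ℂ) :
    ∑ q ∈ Finset.univ.biUnion B, formValue (bandMatrix (N := N) fun _ _ => g q)
        (fun μ => if q ∈ B μ then ζ μ else 0) =
      formValue (bandMatrix fun μ ν α β => ∑ q ∈ B μ ∩ B ν, g q α β) ζ := by
  simp_rw [formValue_bandMatrix]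
  rw [Finset.sum_comm]
  refine Finset.sum_congr rfl fun α _ => ?_
  rw [Finset.sum_comm]
  refine Finset.sum_congr rfl fun β _ => ?_
  rw [Finset.sum_comm]
  refine Finset.sum_congr rfl fun μ _ => ?_
  rw [Finset.sum_comm]
  refine Finset.sum_congr rfl fun ν _ => ?_
  split_ifs
  · rw [Finset.sum_mul, Finset.sum_mul]
    symm
    refine Finset.sum_subset_zero_on_sdiff ?_ ?_ ?_
    · exact fun q hq => Finset.mem_biUnion.mpr ⟨μ, Finset.mem_univ _, (Finset.mem_inter.mp hq).1⟩
    · intro q hq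
      have := (Finset.mem_sdiff.mp hq).2
      rw [Finset.mem_inter, not_and_or] at this
      rcases this with h | h <;> simp [h]
    · intro q hq
      rw [Finset.mem_inter] at hq
      simp [hq.1, hq.2]
  · simp

lemma continuous_bihomEval {n m : ℕ} (c : Matrix (MultiIndex n m) (MultiIndex n m) ℂ) :
    Continuous (bihomEval c) := by
  unfold bihomEval
  refine continuous_finsetSum _ fun α _ => continuous_finsetSum _ fun β _ => ?_
  exact (continuous_const.mul (continuous_monom _)).mul ((continuous_monom _).comp (by fun_prop))

/-- A band matrix whose coefficients are sampled from continuous functions on the simplex that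
agree on the diagonal with the symbol `f (w x)`, where `f` is positive and `w` does not vanish, is
positive definite as soon as the sampling is fine enough. -/
theorem exists_rePosDef_bandMatrix {n m : ℕ} {c : Matrix (MultiIndex n m) (MultiIndex n m) ℂ}
    (hf : ∀ z : Fin n → ℂ, z ≠ 0 → 0 < bihomEval c z)
    {h : (Fin n → ℝ) × (Fin n → ℝ) → MultiIndex n m → MultiIndex n m → ℂ} (hcont : Continuous h)
    {w : (Fin n → ℝ) → Fin n → ℂ} (hw : Continuous w)
    (hdiag : ∀ x α β,
      h (x, x) α β = c α β * monom (w x) α.1 * monom (fun i => conj (w x i)) β.1)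
    (hw0 : ∀ x ∈ stdSimplex ℝ (Fin n), w x ≠ 0) :
    ∃ N₀ : ℕ, 0 < N₀ ∧ ∀ N : ℕ, N₀ ≤ N → RePosDef
      (bandMatrix (N := N) fun μ ν => h (realSimplexPoint μ, realSimplexPoint ν)) := by
  have hΔ := isCompact_stdSimplex (𝕜 := ℝ) (Fin n)
  -- `exists_forall_le'` also covers `n = 0`, where the simplex is empty.
  obtain ⟨δ, δpos, hδ⟩ : ∃ δ : ℝ, 0 < δ ∧ ∀ p ∈ stdSimplex ℝ (Fin n) ×ˢ
      (Set.univ.pi fun _ : Fin n => Metric.sphere (0 : ℂ) 1),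
      δ ≤ (bihomEval c (fun i => w p.1 i * p.2 i)).re := by
    refine (hΔ.prod (isCompact_univ_pi fun _ => isCompact_sphere _ _)).exists_forall_le' ?_ ?_
    · refine Continuous.continuousOn (Complex.continuous_re.comp ?_)
      exact (continuous_bihomEval c).comp (by fun_prop)
    · rintro ⟨x, e⟩ ⟨hx, he⟩
      obtain ⟨i, hi⟩ := Function.ne_iff.mp (hw0 x hx)
      have hei : e i ≠ 0 := by
        have := he i (Set.mem_univ i)
        rw [mem_sphere_zero_iff_norm] at this
        rw [← norm_ne_zero_iff, this]
        exact one_ne_zero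
      exact (Complex.lt_def.mp (hf _ (Function.ne_iff.mpr ⟨i, mul_ne_zero hi hei⟩))).1
  obtain ⟨H, hH0, hH⟩ : ∃ H : ℝ, 0 ≤ H ∧ ∀ x ∈ stdSimplex ℝ (Fin n), ∀ y ∈ stdSimplex ℝ (Fin n),
      ∀ α β, ‖h (x, y) α β‖ ≤ H := by
    obtain ⟨C, hC⟩ := (hΔ.prod hΔ).exists_bound_of_continuousOn hcont.continuousOn
    refine ⟨|C|, abs_nonneg _, fun x hx y hy α β => ?_⟩
    exact ((norm_le_pi_norm _ β).trans (norm_le_pi_norm _ α)).trans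
      ((hC (x, y) ⟨hx, hy⟩).trans (le_abs_self C))
  set D : ℝ := (Fintype.card (MultiIndex n m) : ℝ) ^ 2 with hD
  -- The error is `D ε (H + 1)`: the term `H` pays for missing box overlaps, the term `1` for
  -- freezing. Then `R` is chosen from `ε`, and `N` large compared with `R / η`.
  obtain ⟨ε, εpos, hε⟩ := exists_pos_mul_lt δpos (D * (H + 1))
  obtain ⟨η, ηpos, hη⟩ := Metric.uniformContinuousOn_iff.mp
    ((hΔ.prod hΔ).uniformContinuousOn_of_continuous hcont.continuousOn) ε εpos
  obtain ⟨R, hmR, hR⟩ : ∃ R : ℕ, m ≤ R ∧ (n : ℝ) * m ≤ ε * (R + 1) := by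
    obtain ⟨k, hk⟩ := exists_nat_ge ((n : ℝ) * m / ε)
    refine ⟨max m k, le_max_left _ _, ?_⟩
    have h1 : (k : ℝ) ≤ (max m k : ℕ) := by exact_mod_cast le_max_right _ _
    rw [div_le_iff₀' εpos] at hk
    exact hk.trans (by gcongr; linarith)
  obtain ⟨N₀, hN₀⟩ := exists_nat_gt ((R : ℝ) / η)
  refine ⟨N₀ + 1, by omega, fun N hN ζ hζ => ?_⟩
  have hNpos : 0 < N := by omega
  have hRN : (R : ℝ) / N < η := by
    have h1 : (N₀ : ℝ) ≤ N := by exact_mod_cast (by omega : N₀ ≤ N)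
    rw [div_lt_iff₀ (by positivity)]
    rw [div_lt_iff₀' ηpos] at hN₀
    exact hN₀.trans_le (by gcongr)
  obtain ⟨μ₀, hμ₀⟩ := Function.ne_iff.mp hζ
  have hζpos : 0 < ∑ μ, ‖ζ μ‖ ^ 2 :=
    Finset.sum_pos' (fun _ _ => by positivity)
      ⟨μ₀, Finset.mem_univ _, by have := norm_pos_iff.mpr hμ₀; positivity⟩
  let B : MultiIndex n N → Finset (Fin n → ℕ) := fun μ => Finset.Icc μ.1 (fun i => μ.1 i + R)
  have hBcard : ∀ μ, ((B μ).card : ℝ) = ((R : ℝ) + 1) ^ n := by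
    intro μ
    have : (B μ).card = (R + 1) ^ n := by
      simp only [B, Pi.card_Icc, Nat.card_Icc]
      rw [Finset.prod_congr rfl fun i _ => (by omega : μ.1 i + R + 1 - μ.1 i = R + 1)]
      simp
    rw [this]
    push_cast
    rfl
  -- Freezing at an actual multi-index keeps the sample point on the simplex, where `δ` applies;
  -- outside the boxes `μ₀` is a dummy.
  have hrep : ∀ q, ∃ ρ : MultiIndex n N, q ∈ Finset.univ.biUnion B → q ∈ B ρ := by
    intro q
    by_cases hq : q ∈ Finset.univ.biUnion B
    · obtain ⟨ρ, -, hρ⟩ := Finset.mem_biUnion.mp hq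
      exact ⟨ρ, fun _ => hρ⟩
    · exact ⟨μ₀, fun h => absurd h hq⟩
  choose rep hrep using hrep
  let g : (Fin n → ℕ) → MultiIndex n m → MultiIndex n m → ℂ :=
    fun q => h (realSimplexPoint (rep q), realSimplexPoint (rep q))
  have hlow : δ * (((R : ℝ) + 1) ^ n * ∑ μ, ‖ζ μ‖ ^ 2) ≤
      (formValue (bandMatrix fun μ ν α β => ∑ q ∈ B μ ∩ B ν, g q α β) ζ).re := by
    rw [← sum_formValue_bandMatrix_box, Complex.re_sum]
    have hmass : ((R : ℝ) + 1) ^ n * ∑ μ, ‖ζ μ‖ ^ 2 =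
        ∑ q ∈ Finset.univ.biUnion B, ∑ μ, ‖if q ∈ B μ then ζ μ else 0‖ ^ 2 := by
      rw [Finset.sum_comm, Finset.mul_sum]
      refine Finset.sum_congr rfl fun μ _ => ?_
      rw [← hBcard μ, ← nsmul_eq_mul, ← Finset.sum_const]
      refine Finset.sum_subset_zero_on_sdiff ?_ ?_ ?_
      · exact fun q hq => Finset.mem_biUnion.mpr ⟨μ, Finset.mem_univ _, hq⟩
      · intro q hq
        simp [(Finset.mem_sdiff.mp hq).2]
      · intro q hq
        simp [hq]
    rw [hmass, Finset.mul_sum]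
    refine Finset.sum_le_sum fun q _ => ?_
    have hg : g q = fun α β => c α β * monom (w (realSimplexPoint (rep q))) α.1 *
        monom (fun i => conj (w (realSimplexPoint (rep q)) i)) β.1 := by
      funext α β
      exact hdiag _ α β
    rw [hg]
    refine le_re_formValue_toeplitz c _ (fun e he => ?_) _
    exact hδ (realSimplexPoint (rep q), e)
      ⟨realSimplexPoint_mem hNpos _, fun i _ => mem_sphere_zero_iff_norm.mpr (he i)⟩
  have hdiff : ‖formValue (bandMatrix fun μ ν α β =>
      (((R : ℝ) + 1) ^ n : ℝ) * h (realSimplexPoint μ, realSimplexPoint ν) α β -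
        ∑ q ∈ B μ ∩ B ν, g q α β) ζ‖ ≤
      D * (((R : ℝ) + 1) ^ n * (ε * (H + 1)) * ∑ μ, ‖ζ μ‖ ^ 2) := by
    refine norm_formValue_bandMatrix_le _ (by positivity) (fun μ ν α β hr => ?_) ζ
    have hμν : ∀ i, μ.1 i ≤ ν.1 i + m := fun i => by
      have h1 := congrFun hr i
      have h2 := α.apply_le i
      simp only [Pi.add_apply] at h1
      omega
    have hνμ : ∀ i, ν.1 i ≤ μ.1 i + m := fun i => by
      have h1 := congrFun hr i
      have h2 := β.apply_le i
      simp only [Pi.add_apply] at h1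
      omega
    have hcard : (1 - ε) * ((R : ℝ) + 1) ^ n ≤ ((B μ ∩ B ν).card : ℝ) :=
      le_card_Icc_inter_Icc hmR hR hμν hνμ
    have hcard' : ((B μ ∩ B ν).card : ℝ) ≤ ((R : ℝ) + 1) ^ n := by
      rw [← hBcard μ]
      exact_mod_cast Finset.card_le_card Finset.inter_subset_left
    set x := h (realSimplexPoint μ, realSimplexPoint ν) α β with hx
    have hxH : ‖x‖ ≤ H :=
      hH _ (realSimplexPoint_mem hNpos _) _ (realSimplexPoint_mem hNpos _) _ _
    have hclose : ∀ q ∈ B μ ∩ B ν, ‖x - g q α β‖ ≤ ε := by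
      intro q hq
      obtain ⟨h1, h2⟩ := Finset.mem_inter.mp hq
      have h3 := hrep q (Finset.mem_biUnion.mpr ⟨μ, Finset.mem_univ _, h1⟩)
      have h4 := hη (realSimplexPoint μ, realSimplexPoint ν)
        ⟨realSimplexPoint_mem hNpos _, realSimplexPoint_mem hNpos _⟩
        (realSimplexPoint (rep q), realSimplexPoint (rep q))
        ⟨realSimplexPoint_mem hNpos _, realSimplexPoint_mem hNpos _⟩
        (max_lt ((dist_realSimplexPoint_le h1 h3).trans_lt hRN)
          ((dist_realSimplexPoint_le h2 h3).trans_lt hRN))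
      rw [← dist_eq_norm]
      exact ((dist_le_pi_dist _ _ β).trans (dist_le_pi_dist _ _ α)).trans h4.le
    -- Separates the overlap deficit from the freezing error.
    have hsplit : ((((R : ℝ) + 1) ^ n : ℝ) : ℂ) * x - ∑ q ∈ B μ ∩ B ν, g q α β =
        ((((R : ℝ) + 1) ^ n - (B μ ∩ B ν).card : ℝ) : ℂ) * x + ∑ q ∈ B μ ∩ B ν, (x - g q α β) := by
      rw [Finset.sum_sub_distrib, Finset.sum_const, nsmul_eq_mul]
      push_cast
      ring
    rw [hsplit]
    calc _ ≤ ‖((((R : ℝ) + 1) ^ n - (B μ ∩ B ν).card : ℝ) : ℂ) * x‖ +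
          ‖∑ q ∈ B μ ∩ B ν, (x - g q α β)‖ := norm_add_le _ _
      _ ≤ (((R : ℝ) + 1) ^ n * ε) * H + ((B μ ∩ B ν).card : ℝ) * ε := by
          gcongr
          · rw [norm_mul, Complex.norm_real, Real.norm_eq_abs, abs_of_nonneg (by linarith)]
            gcongr
            linarith
          · rw [← nsmul_eq_mul, ← Finset.sum_const]
            exact norm_sum_le_of_le _ hclose
      _ ≤ (((R : ℝ) + 1) ^ n * ε) * H + ((R : ℝ) + 1) ^ n * ε := by gcongr
      _ = _ := by ring
  have hlin : formValue (bandMatrix fun μ ν α β =>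
      (((R : ℝ) + 1) ^ n : ℝ) * h (realSimplexPoint μ, realSimplexPoint ν) α β -
        ∑ q ∈ B μ ∩ B ν, g q α β) ζ =
      (((R : ℝ) + 1) ^ n : ℝ) * formValue (bandMatrix fun μ ν =>
        h (realSimplexPoint μ, realSimplexPoint ν)) ζ -
      formValue (bandMatrix fun μ ν α β => ∑ q ∈ B μ ∩ B ν, g q α β) ζ := by
    simp only [formValue_bandMatrix, Finset.mul_sum, ← Finset.sum_sub_distrib]
    refine Finset.sum_congr rfl fun α _ => Finset.sum_congr rfl fun β _ =>
      Finset.sum_congr rfl fun μ _ => Finset.sum_congr rfl fun ν _ => ?_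
    split_ifs
    · ring
    · simp
  rw [hlin] at hdiff
  have hre := (abs_le.mp ((Complex.abs_re_le_norm _).trans hdiff)).1
  rw [Complex.sub_re, Complex.re_ofReal_mul] at hre
  have hRpos : (0 : ℝ) < ((R : ℝ) + 1) ^ n := by positivity
  refine pos_of_mul_pos_right (a := ((R : ℝ) + 1) ^ n) ?_ hRpos.le
  change 0 < ((R : ℝ) + 1) ^ n * (formValue _ ζ).re
  have hgap : 0 < (δ - D * (H + 1) * ε) * (((R : ℝ) + 1) ^ n * ∑ μ, ‖ζ μ‖ ^ 2) :=
    mul_pos (by linarith) (mul_pos hRpos hζpos)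
  linarith

/-! ### The matrices of the theorem -/

lemma simplexPoint_eq {n N : ℕ} (μ : MultiIndex n N) :
    simplexPoint μ = fun i => ((realSimplexPoint μ i : ℝ) : ℂ) := rfl

lemma exists_pos_of_mem_stdSimplex {n : ℕ} {x : Fin n → ℝ} (hx : x ∈ stdSimplex ℝ (Fin n)) :
    ∃ i, 0 < x i := by
  by_contra! hle
  have := Finset.sum_nonpos fun i (_ : i ∈ Finset.univ) => hle i
  rw [hx.2] at this
  linarith

lemma isHermitian_matrixL {n m : ℕ} {c : Matrix (MultiIndex n m) (MultiIndex n m) ℂ}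
    (hc : c.IsHermitian) (N : ℕ) : (matrixL c N).IsHermitian := by
  have hreal : ∀ (μ : MultiIndex n N) (α : Fin n → ℕ),
      conj (monom (simplexPoint μ) α) = monom (simplexPoint μ) α := by
    intro μ α
    rw [← monom_conj, simplexPoint_eq]
    simp only [Complex.conj_ofReal]
  ext μ ν
  rw [Matrix.conjTranspose_apply, Complex.star_def]
  simp only [matrixL, map_sum]
  rw [Finset.sum_comm]
  refine Finset.sum_congr rfl fun β _ => Finset.sum_congr rfl fun α _ => ?_
  have hiff : α.1 + μ.1 = β.1 + ν.1 ↔ β.1 + ν.1 = α.1 + μ.1 := eq_comm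
  rw [apply_ite conj, map_zero]
  refine if_congr hiff ?_ rfl
  rw [map_mul, map_mul, hreal, hreal, ← Complex.star_def, hc.apply]
  ring

lemma posDef_of_rePosDef {ι : Type} [Fintype ι] {M : Matrix ι ι ℂ} (hM : M.IsHermitian)
    (hpos : RePosDef M) : M.PosDef := by
  refine Matrix.PosDef.of_dotProduct_mulVec_pos hM fun x hx => ?_
  have him : (star x ⬝ᵥ M.mulVec x).im = 0 := hM.im_star_dotProduct_mulVec_self x
  -- `RePosDef` conjugates the column variable while `PosDef` conjugates the row variable, hence
  -- `star x`.
  have hre := hpos (star x) (star_ne_zero.mpr hx)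
  have hsum : star x ⬝ᵥ M.mulVec x = ∑ μ, ∑ ν, M μ ν * star x μ * conj (star x ν) := by
    simp only [dotProduct, Matrix.mulVec, Finset.mul_sum, Pi.star_apply, Complex.star_def,
      Complex.conj_conj]
    exact Finset.sum_congr rfl fun μ _ => Finset.sum_congr rfl fun ν _ => by ring
  rw [Complex.lt_def]
  exact ⟨hsum ▸ hre, him.symm⟩

theorem corollary1 (n m : ℕ) (c : Matrix (MultiIndex n m) (MultiIndex n m) ℂ)
    (hf : ∀ z : Fin n → ℂ, z ≠ 0 → 0 < bihomEval c z) :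
    ∃ N₀ : ℕ, ∀ N : ℕ, N₀ ≤ N →
      (matrixL c N).PosDef ∧ RePosDef (matrixASqrt c N) ∧ RePosDef (matrixAColumn c N) := by
  have hw0 : ∀ x ∈ stdSimplex ℝ (Fin n), (fun i => ((x i : ℝ) : ℂ)) ≠ 0 := by
    intro x hx
    obtain ⟨i, hi⟩ := exists_pos_of_mem_stdSimplex hx
    exact Function.ne_iff.mpr ⟨i, by simpa using hi.ne'⟩
  have hs0 : ∀ x ∈ stdSimplex ℝ (Fin n), (fun i => ((Real.sqrt (x i) : ℝ) : ℂ)) ≠ 0 := by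
    intro x hx
    obtain ⟨i, hi⟩ := exists_pos_of_mem_stdSimplex hx
    exact Function.ne_iff.mpr ⟨i, by simpa using (Real.sqrt_pos.mpr hi).ne'⟩
  obtain ⟨N₁, hN₁, h₁⟩ := exists_rePosDef_bandMatrix hf
    (h := fun p α β => c α β * monom (fun i => ((p.1 i : ℝ) : ℂ)) α.1 *
      monom (fun i => ((p.2 i : ℝ) : ℂ)) β.1)
    (w := fun x i => ((x i : ℝ) : ℂ))
    (by unfold monom; fun_prop) (by fun_prop) (fun x α β => by simp) hw0
  obtain ⟨N₂, hN₂, h₂⟩ := exists_rePosDef_bandMatrix hf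
    (h := fun p α β => c α β * monom (fun i => ((Real.sqrt (p.2 i) : ℝ) : ℂ)) α.1 *
      monom (fun i => conj ((Real.sqrt (p.2 i) : ℝ) : ℂ)) β.1)
    (w := fun x i => ((Real.sqrt (x i) : ℝ) : ℂ))
    (by unfold monom; fun_prop) (by fun_prop) (fun x α β => rfl) hs0
  obtain ⟨N₃, hN₃, h₃⟩ := exists_rePosDef_bandMatrix hf
    (h := fun p α β => c α β * monom (fun i => ((p.2 i : ℝ) : ℂ)) (α.1 + β.1))
    (w := fun x i => ((x i : ℝ) : ℂ))
    (by unfold monom; fun_prop) (by fun_prop)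
    (fun x α β => by simp [monom_add, mul_assoc]) hw0
  refine ⟨max N₁ (max N₂ N₃), fun N hN => ⟨?_, h₂ N (by omega), h₃ N (by omega)⟩⟩
  refine posDef_of_rePosDef ?_ (h₁ N (by omega))
  -- For `n = 0` positivity is vacuous and `c` need not be Hermitian, but there are no multi-indices
  -- of degree `N > 0`.
  rcases Nat.eq_zero_or_pos n with rfl | hn
  · ext μ
    have := μ.2
    simp at this
    omega
  · have : Nonempty (Fin n) := ⟨⟨0, hn⟩⟩
    have : (nhdsWithin (0 : Fin n → ℂ) {0}ᶜ).NeBot := Module.punctured_nhds_neBot ℂ _ _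
    refine isHermitian_matrixL (isHermitian_of_bihomEval_real fun z => ?_) N
    -- The hypothesis omits `z = 0`; reality there follows by density and continuity.
    refine congrFun (Continuous.ext_on (dense_compl_singleton (0 : Fin n → ℂ))
      (Complex.continuous_conj.comp (continuous_bihomEval c)) (continuous_bihomEval c)
      fun z hz => ?_) z
    exact Complex.conj_eq_iff_im.mpr (Complex.lt_def.mp (hf z hz)).2.symm
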